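/- Let $\mathbb{D}=\{z\in\mathbb{C}:|z|<1\}$. Let $\Omega\subsetneq\mathbb{C}$ be a domain with $1\in\Omega$ that is starlike with respect to $1$, i.e. for every $w\in\Omega$ the segment from $1$ to $w$ lies in $\Omega$. Let $\phi_\Omega$ be the unique conformal map (holomorphic bijection) of $\mathbb{D}$ onto $\Omega$ with $\phi_\Omega(0)=1$ and $\phi_\Omega'(0)>0$, and put $$k_\Omega(z)=\int_0^z\exp\left(\int_0^t\frac{\phi_\Omega(\zeta)-1}{\zeta}\,d\zeta\right)dt,\qquad z\in\mathbb{D}.$$ Let $\mathcal{C}(\Omega)$ be the class of all holomorphic functions $f$ on $\mathbb{D}$ with $f(0)=0$, $f'(0)=1$ and $$f'(z)\neq 0,\qquad 1+\frac{zf''(z)}{f'(z)}\in\Omega\qquad\text{for all } z\in\mathbb{D}.$$ For $0<r<1$ and $f$ holomorphic on $\mathbb{D}$ let $$L_r(f)=\int_{-\pi}^{\pi}r\,|f'(re^{i\theta})|\,d\theta$$ be the arclength of the image of the circle $|z|=r$. Then for every $f\in\mathcal{C}(\Omega)$ and every $r\in(0,1)$, $$L_r(f)\leq L_r(k_\Omega),$$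 and, for each such $f$ and $r$, equality holds if and only if there is $\varepsilon\in\mathbb{C}$ with $|\varepsilon|=1$ such that $f(z)=\overline{\varepsilon}\,k_\Omega(\varepsilon z)$ for all $z\in\mathbb{D}$. -/

import Mathlib

noncomputable section

namespace ArclengthProblem

/-- The open unit disk `𝔻` of the complex plane. -/
def unitDisk : Set ℂ := Metric.ball (0 : ℂ) 1

/-- `φ` is the conformal map of the unit disk onto `Ω`, normalized by `φ 0 = 1` and `φ' 0 > 0`:
holomorphic on the disk and a bijection of the disk onto `Ω`. These conditions determine `φ` on the
disk; nothing is said about its values elsewhere. -/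
structure IsNormalizedConformalMap (φ : ℂ → ℂ) (Ω : Set ℂ) : Prop where
  holomorphic : DifferentiableOn ℂ φ unitDisk
  bijOn : Set.BijOn φ unitDisk Ω
  map_zero : φ 0 = 1
  deriv_re_pos : 0 < (deriv φ 0).re
  deriv_im_eq_zero : (deriv φ 0).im = 0

/-- The complex line integral `∫₀ᶻ g(ζ) dζ` along the segment from `0` to `z`, parametrized by
`ζ = s z` with `0 ≤ s ≤ 1`. -/
def segmentIntegral (g : ℂ → ℂ) (z : ℂ) : ℂ :=
  ∫ s in (0 : ℝ)..1, g ((s : ℂ) * z) * z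

/-- The function `k(z) = ∫₀ᶻ exp (∫₀ᵗ (φ(ζ) - 1) / ζ dζ) dt` attached to `φ`. The singularity at
`ζ = 0` of the inner integrand is removable when `φ` is holomorphic with `φ 0 = 1`; the value that
division by zero gives at this one point does not affect the integral. -/
def extremalFunction (φ : ℂ → ℂ) (z : ℂ) : ℂ :=
  segmentIntegral (fun t => Complex.exp (segmentIntegral (fun ζ => (φ ζ - 1) / ζ) t)) z

/-- The class `𝒞(Ω)` of holomorphic functions on the unit disk with `f 0 = 0`, `f' 0 = 1` and
`1 + z f''(z) / f'(z) ∈ Ω` on the disk. The condition `f' z ≠ 0` says that the quotient is defined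
as a finite complex number. -/
structure ClassC (Ω : Set ℂ) (f : ℂ → ℂ) : Prop where
  holomorphic : DifferentiableOn ℂ f unitDisk
  map_zero : f 0 = 0
  deriv_zero : deriv f 0 = 1
  deriv_ne_zero : ∀ z ∈ unitDisk, deriv f z ≠ 0
  mem : ∀ z ∈ unitDisk, 1 + z * deriv (deriv f) z / deriv f z ∈ Ω

/-- The arclength `L_r(f) = ∫_{-π}^{π} r |f'(r e^{iθ})| dθ` of the image of the circle `|z| = r`. -/
def arclength (r : ℝ) (f : ℂ → ℂ) : ℝ :=
  ∫ θ in (-Real.pi)..Real.pi, r * ‖deriv f ((r : ℂ) * Complex.exp ((θ : ℂ) * Complex.I))‖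

end ArclengthProblem

end

/-! Write `f' = exp h` and `k' = exp G`, so that `z G' = φ - 1`, while Schwarz applied to `φ⁻¹ ∘ (1
+ z f''/f')` gives `z h' = φ(v) - 1` with `‖v‖ ≤ ‖z‖`. The central claim (`exists_subordination`) is
that `h = G ∘ ω` with `‖ω z‖ ≤ ‖z‖`. Since `G' ≠ 0`, `h` lifts through `G` locally. At a point where
`‖ω‖` is maximal on a closed disk, Jack's lemma gives `z ω' = m ω` with `m ≥ 1`, hence `φ(ω) - 1 =
m⁻¹ (φ(v) - 1)`; starlikeness then forces `‖ω‖ ≤ ‖v‖ ≤ ‖z‖`. This a priori bound lets the lift be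
continued to every disk of radius below `1`.

With `Q = exp (G / 2)` the arclengths are multiples of the mean squares of `Q ∘ ω` and `Q`, so the
inequality is Littlewood's theorem (`meanSq_comp_le`). As `Q' 0 ≠ 0`, it is strict if `‖ω‖ < r` on
the circle (`meanSq_comp_lt`). Equality therefore makes `ω` a rotation, by the equality case of
Schwarz. -/

namespace ArclengthProblem

open Set Metric Filter Topology Complex

/-! ### Holomorphy of the inverse of an injective holomorphic map. -/

section Inverse

variable {U : Set ℂ} {F ψ : ℂ → ℂ}

theorem nhds_le_map_of_injOn (hU : IsOpen U) (hF : DifferentiableOn ℂ F U) (hinj : InjOn F U)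
    {z : ℂ} (hz : z ∈ U) : 𝓝 (F z) ≤ map F (𝓝 z) := by
  refine (hF.analyticAt (hU.mem_nhds hz)).eventually_constant_or_nhds_le_map_nhds.resolve_left ?_
  intro h
  have h1 : ∀ᶠ w in 𝓝 z, w = z := by
    filter_upwards [h, hU.mem_nhds hz] with w hw hwU using hinj hwU hz hw
  have h2 : ∀ᶠ w in 𝓝[≠] z, w = z := h1.filter_mono nhdsWithin_le_nhds
  have h3 : ∀ᶠ w in 𝓝[≠] z, False := by
    filter_upwards [h2, self_mem_nhdsWithin] with w hw hw' using hw' hw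
  exact (NeBot.ne inferInstance : (𝓝[≠] z) ≠ ⊥) (eventually_false_iff_eq_bot.1 h3)

theorem isOpen_image_of_injOn (hU : IsOpen U) (hF : DifferentiableOn ℂ F U) (hinj : InjOn F U) :
    IsOpen (F '' U) := by
  rw [isOpen_iff_mem_nhds]
  rintro _ ⟨z, hz, rfl⟩
  exact nhds_le_map_of_injOn hU hF hinj hz (image_mem_map (hU.mem_nhds hz))

theorem continuousAt_leftInverse (hU : IsOpen U) (hF : DifferentiableOn ℂ F U) (hinj : InjOn F U)
    (hψ : LeftInvOn ψ F U) {z : ℂ} (hz : z ∈ U) : ContinuousAt ψ (F z) := by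
  have h : Tendsto ψ (map F (𝓝 z)) (𝓝 z) := by
    rw [tendsto_map'_iff]
    refine (tendsto_id (α := ℂ)).congr' ?_
    filter_upwards [hU.mem_nhds hz] with w hw using (hψ hw).symm
  rw [ContinuousAt, hψ hz]
  exact h.mono_left (nhds_le_map_of_injOn hU hF hinj hz)

theorem eventually_deriv_ne_zero_of_injOn (hU : IsOpen U) (hF : DifferentiableOn ℂ F U)
    (hinj : InjOn F U) {z : ℂ} (hz : z ∈ U) : ∀ᶠ w in 𝓝[≠] z, deriv F w ≠ 0 := by
  have hA : AnalyticAt ℂ (deriv F) z := (hF.analyticAt (hU.mem_nhds hz)).deriv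
  refine hA.eventually_eq_zero_or_eventually_ne_zero.resolve_left ?_
  intro h
  obtain ⟨ε, hε, hb⟩ := Metric.eventually_nhds_iff_ball.1 (h.and (hU.mem_nhds hz))
  have hw : z + (ε / 2 : ℝ) ∈ ball z ε := by
    simp [abs_of_pos hε, hε]
  have hconst : F (z + (ε / 2 : ℝ)) = F z := by
    refine isOpen_ball.is_const_of_deriv_eq_zero (convex_ball z ε).isPreconnected
      (hF.mono fun w hw => (hb w hw).2) (fun w hw => (hb w hw).1) hw (mem_ball_self hε)
  have := hinj (hb _ hw).2 hz hconst
  simp [hε.ne'] at this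

/-- The derivative of `F` has isolated zeros, so near each image point the inverse is differentiable
except perhaps at that point. It is continuous there by the open mapping theorem, so the singularity
is removable. -/
theorem differentiableOn_leftInverse (hU : IsOpen U) (hF : DifferentiableOn ℂ F U)
    (hinj : InjOn F U) (hψ : LeftInvOn ψ F U) : DifferentiableOn ℂ ψ (F '' U) := by
  rintro _ ⟨z, hz, rfl⟩
  refine DifferentiableAt.differentiableWithinAt ?_
  refine (analyticAt_of_differentiable_on_punctured_nhds_of_continuousAt ?_
    (continuousAt_leftInverse hU hF hinj hψ hz)).differentiableAt
  have hmap : ∀ᶠ y in map F (𝓝 z), y ≠ F z → DifferentiableAt ℂ ψ y := by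
    rw [eventually_map]
    filter_upwards [hU.mem_nhds hz,
      eventually_nhdsWithin_iff.1 (eventually_deriv_ne_zero_of_injOn hU hF hinj hz)] with w hw hd hne
    have hwz : w ≠ z := fun h => hne (by rw [h])
    refine (HasDerivAt.of_local_left_inverse (f := F) (f' := deriv F w)
      (continuousAt_leftInverse hU hF hinj hψ hw) ?_ (hd hwz) ?_).differentiableAt
    · rw [hψ hw]
      exact (hF.differentiableAt (hU.mem_nhds hw)).hasDerivAt
    · filter_upwards [(isOpen_image_of_injOn hU hF hinj).mem_nhds (mem_image_of_mem F hw)]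
        with y hy
      obtain ⟨x, hx, rfl⟩ := hy
      rw [hψ hx]
  exact eventually_nhdsWithin_iff.2 (nhds_le_map_of_injOn hU hF hinj hz hmap)

end Inverse

/-! ### Starlikeness, Jack's lemma and the a priori Schwarz bound. -/

/-- A starlike conformal map is decreasing in modulus along the contraction towards its centre. -/
theorem norm_le_norm_of_contraction {Ω : Set ℂ} (hΩ : StarConvex ℝ (1 : ℂ) Ω) {φ : ℂ → ℂ}
    (hφ : IsNormalizedConformalMap φ Ω) {t : ℝ} (ht0 : 0 ≤ t) (ht1 : t ≤ 1) {a b : ℂ}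
    (ha : a ∈ unitDisk) (hb : b ∈ unitDisk) (h : φ a - 1 = t * (φ b - 1)) : ‖a‖ ≤ ‖b‖ := by
  have h0 : (0 : ℂ) ∈ unitDisk := mem_ball_self one_pos
  have hL : LeftInvOn (Function.invFunOn φ unitDisk) φ unitDisk := hφ.bijOn.injOn.leftInvOn_invFunOn
  have hd : DifferentiableOn ℂ (Function.invFunOn φ unitDisk) (φ '' unitDisk) :=
    differentiableOn_leftInverse isOpen_ball hφ.holomorphic hφ.bijOn.injOn hL
  rw [hφ.bijOn.image_eq] at hd
  set ψ := Function.invFunOn φ unitDisk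
  have hm : MapsTo (fun z => 1 + (t : ℂ) * (φ z - 1)) unitDisk Ω := by
    intro z hz
    have := hΩ (hφ.bijOn.mapsTo hz) (sub_nonneg.2 ht1) ht0 (by ring)
    convert this using 1
    simp [Complex.real_smul]
    ring
  have hψm : MapsTo ψ Ω unitDisk := by
    intro w hw
    rw [← hφ.bijOn.image_eq] at hw
    obtain ⟨z, hz, rfl⟩ := hw
    rwa [hL hz]
  -- Starlikeness makes `φ⁻¹ ∘ (1 + t (φ - 1))` a self-map of the disk; it fixes `0` and sends `b`
  -- to `a`.
  have hS := Complex.norm_le_norm_of_mapsTo_ball (f := fun z => ψ (1 + (t : ℂ) * (φ z - 1)))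
    (R := 1) (z := b) (hd.comp (((hφ.holomorphic.sub_const 1).const_mul _).const_add 1) hm)
    (fun z hz => ball_subset_closedBall (hψm (hm hz)))
    (by simpa [hφ.map_zero] using hL h0) (by simpa [unitDisk] using hb)
  have : 1 + (t : ℂ) * (φ b - 1) = φ a := by rw [← h]; ring
  rwa [this, hL ha] at hS

theorem hasDerivAt_normSq_comp {u : ℝ → ℂ} {u' : ℂ} {x : ℝ} (hu : HasDerivAt u u' x) :
    HasDerivAt (fun x => ‖u x‖ ^ 2) (2 * ((u x).re * u'.re + (u x).im * u'.im)) x := by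
  have h := (hu.norm_sq)
  simpa [Complex.inner, mul_comm] using h

theorem hasDerivAt_comp_exp {ω : ℂ → ℂ} {z₀ : ℂ} (hω : DifferentiableAt ℂ ω z₀) (c : ℂ) :
    HasDerivAt (fun x : ℝ => ω (exp (c * x) * z₀)) (c * (z₀ * deriv ω z₀)) 0 := by
  have h1 : HasDerivAt (fun x : ℝ => exp (c * x) * z₀) (c * z₀) 0 := by
    have h2 : HasDerivAt (fun x : ℝ => c * (x : ℂ)) c 0 := by
      simpa using (ofRealCLM.hasDerivAt (x := (0 : ℝ))).const_mul c
    simpa using h2.cexp.mul_const z₀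
  have h3 : HasDerivAt ω (deriv ω z₀) (exp (c * (0 : ℝ)) * z₀) := by
    simpa using hω.hasDerivAt
  have h4 := h3.comp (0 : ℝ) h1
  rwa [show deriv ω z₀ * (c * z₀) = c * (z₀ * deriv ω z₀) by ring] at h4

theorem nonneg_of_hasDerivAt_of_le {q : ℝ → ℝ} {q' : ℝ} (hq : HasDerivAt q q' 0)
    (hle : ∀ x ≤ 0, q x ≤ q 0) : 0 ≤ q' := by
  have h := (hasDerivAt_iff_tendsto_slope.1 hq).mono_left
    (nhdsWithin_mono (0 : ℝ) (s := Iio 0) (fun x (hx : x < 0) => hx.ne))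
  refine ge_of_tendsto h ?_
  filter_upwards [self_mem_nhdsWithin] with x hx
  have hx' : x < 0 := hx
  rw [slope_def_field, sub_zero]
  exact div_nonneg_of_nonpos (sub_nonpos.2 (hle x hx'.le)) hx'.le

/-- **Jack's lemma.** -/
theorem exists_mul_deriv_eq_of_isMax {ω : ℂ → ℂ} {z₀ : ℂ} {s : ℝ} (hz₀ : ‖z₀‖ < s)
    (hω : DifferentiableOn ℂ ω (ball 0 s)) (h0 : ω 0 = 0) (hne : ω z₀ ≠ 0)
    (hmax : ∀ z, ‖z‖ ≤ ‖z₀‖ → ‖ω z‖ ≤ ‖ω z₀‖) :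
    ∃ m : ℝ, 1 ≤ m ∧ z₀ * deriv ω z₀ = m * ω z₀ := by
  have hz₀ne : z₀ ≠ 0 := by
    rintro rfl
    exact hne h0
  have hpos : 0 < ‖z₀‖ := norm_pos_iff.2 hz₀ne
  have hd : DifferentiableAt ℂ ω z₀ :=
    hω.differentiableAt (isOpen_ball.mem_nhds (by simpa using hz₀))
  set A := z₀ * deriv ω z₀ with hA
  set B := ω z₀ with hB
  -- `‖ω‖ ^ 2` is stationary along the circle through `z₀`, which makes `A / B` real.
  have hang : B.re * (I * A).re + B.im * (I * A).im = 0 := by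
    have hder := hasDerivAt_normSq_comp (hasDerivAt_comp_exp hd I)
    have hloc : IsLocalMax (fun x : ℝ => ‖ω (exp (I * x) * z₀)‖ ^ 2) 0 := by
      refine Eventually.of_forall fun x => ?_
      have : ‖exp (I * x) * z₀‖ ≤ ‖z₀‖ := by
        rw [norm_mul, mul_comm I, norm_exp_ofReal_mul_I, one_mul]
      have h2 := hmax _ this
      simp only [ofReal_zero, mul_zero, exp_zero, one_mul]
      gcongr
    have := hloc.hasDerivAt_eq_zero hder
    simpa [hA, hB] using this
  -- Schwarz on the disk of radius `‖z₀‖` gives `‖ω (eˣ z₀)‖ ≤ eˣ ‖B‖` for `x ≤ 0`, with equality at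
  -- `x = 0`; comparing one-sided derivatives of the squares yields `m ≥ 1`.
  have hrad : 0 ≤ 2 * (B.re * A.re + B.im * A.im) - 2 * ‖B‖ ^ 2 := by
    have hder := hasDerivAt_normSq_comp (hasDerivAt_comp_exp hd 1)
    have he : HasDerivAt (fun x : ℝ => Real.exp (2 * x) * ‖B‖ ^ 2) (2 * ‖B‖ ^ 2) 0 := by
      have h2 : HasDerivAt (fun x : ℝ => 2 * x) 2 0 := by
        simpa using (hasDerivAt_id (0 : ℝ)).const_mul 2
      simpa using h2.exp.mul_const (‖B‖ ^ 2)
    have hsub := hder.sub he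
    have hnn := nonneg_of_hasDerivAt_of_le hsub ?_
    · simpa [hA, hB] using hnn
    intro x hx
    have hS : ‖ω (exp (1 * x) * z₀)‖ ≤ Real.exp x * ‖B‖ := by
      have hnorm : ‖exp (1 * (x : ℂ)) * z₀‖ = Real.exp x * ‖z₀‖ := by
        rw [norm_mul, one_mul, norm_exp, ofReal_re]
      rcases hx.eq_or_lt with rfl | hx
      · simp [hB]
      have hlt : exp (1 * (x : ℂ)) * z₀ ∈ ball (0 : ℂ) ‖z₀‖ := by
        rw [mem_ball_zero_iff, hnorm]
        exact mul_lt_of_lt_one_left hpos (by simpa using hx)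
      have h2 := Complex.dist_le_div_mul_dist_of_mapsTo_ball (f := ω) (R₂ := ‖B‖)
        (hω.mono (ball_subset_ball hz₀.le)) (fun z hz => by
          rw [h0, mem_closedBall_zero_iff]
          exact hmax z (by simpa using (mem_ball_zero_iff.1 hz).le)) hlt
      rw [h0, dist_zero_right, dist_zero_right, hnorm] at h2
      refine h2.trans_eq ?_
      field_simp
    have hsq : ‖ω (exp (1 * x) * z₀)‖ ^ 2 ≤ Real.exp (2 * x) * ‖B‖ ^ 2 := by
      calc _ ≤ (Real.exp x * ‖B‖) ^ 2 := by gcongr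
        _ = _ := by rw [mul_pow, ← Real.exp_nat_mul]; norm_num
    simpa [hB] using hsq
  have hBpos : 0 < ‖B‖ ^ 2 := by positivity
  have hBsq : ‖B‖ ^ 2 = B.re * B.re + B.im * B.im := by
    rw [← normSq_eq_norm_sq, normSq_apply]
  have hang' : B.re * A.im = B.im * A.re := by
    simp at hang
    linarith
  refine ⟨(B.re * A.re + B.im * A.im) / ‖B‖ ^ 2, ?_, ?_⟩
  · rw [le_div_iff₀ hBpos]
    linarith
  · have hBC : ((‖B‖ ^ 2 : ℝ) : ℂ) ≠ 0 := by exact_mod_cast hBpos.ne'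
    rw [ofReal_div, div_mul_eq_mul_div, eq_div_iff hBC]
    apply Complex.ext
    · simp only [mul_re, ofReal_re, ofReal_im, hBsq]
      linear_combination (-B.im) * hang'
    · simp only [ofReal_re, ofReal_im, mul_im, hBsq]
      linear_combination B.re * hang'

/-- If `z h' = φ ∘ v - 1` with `‖v z‖ ≤ ‖z‖` and `z G' = φ - 1`, any holomorphic solution
`ω` of `G ∘ ω = h` with `ω 0 = 0` satisfies the Schwarz bound. -/
theorem norm_le_of_comp_eq {Ω : Set ℂ} (hΩ : StarConvex ℝ (1 : ℂ) Ω) {φ G h ω : ℂ → ℂ} {s : ℝ}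
    (hφ : IsNormalizedConformalMap φ Ω) (hG : DifferentiableOn ℂ G unitDisk)
    (hG' : ∀ z ∈ unitDisk, z * deriv G z = φ z - 1)
    (hh : ∀ z ∈ ball (0 : ℂ) s, ∃ v ∈ unitDisk, ‖v‖ ≤ ‖z‖ ∧ z * deriv h z = φ v - 1)
    (hω : DifferentiableOn ℂ ω (ball 0 s)) (hmaps : MapsTo ω (ball 0 s) unitDisk) (h0 : ω 0 = 0)
    (hGω : ∀ z ∈ ball (0 : ℂ) s, G (ω z) = h z) {z : ℂ} (hz : z ∈ ball (0 : ℂ) s) :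
    ‖ω z‖ ≤ ‖z‖ := by
  rw [mem_ball_zero_iff] at hz
  obtain ⟨z₀, hz₀, hmax⟩ := (isCompact_closedBall (0 : ℂ) ‖z‖).exists_isMaxOn
    ⟨0, by simp⟩ ((hω.mono (closedBall_subset_ball hz)).continuousOn.norm)
  rw [mem_closedBall_zero_iff] at hz₀
  have hmax' : ∀ w, ‖w‖ ≤ ‖z‖ → ‖ω w‖ ≤ ‖ω z₀‖ := fun w hw =>
    hmax (mem_closedBall_zero_iff.2 hw)
  refine (hmax' z le_rfl).trans (le_trans ?_ hz₀)
  have hz₀s : z₀ ∈ ball (0 : ℂ) s := mem_ball_zero_iff.2 (hz₀.trans_lt hz)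
  rcases eq_or_ne (ω z₀) 0 with h1 | h1
  · simp [h1]
  obtain ⟨m, hm, hmeq⟩ := exists_mul_deriv_eq_of_isMax (hz₀.trans_lt hz) hω h0 h1
    (fun w hw => hmax' w (hw.trans hz₀))
  obtain ⟨v, hv, hvz, hveq⟩ := hh z₀ hz₀s
  have hchain : deriv h z₀ = deriv G (ω z₀) * deriv ω z₀ := by
    have h2 : HasDerivAt (fun w => G (ω w)) (deriv G (ω z₀) * deriv ω z₀) z₀ :=
      (hG.differentiableAt (isOpen_ball.mem_nhds (hmaps hz₀s))).hasDerivAt.comp z₀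
        (hω.differentiableAt (isOpen_ball.mem_nhds hz₀s)).hasDerivAt
    rw [← h2.deriv]
    refine Filter.EventuallyEq.deriv_eq ?_
    filter_upwards [isOpen_ball.mem_nhds hz₀s] with w hw using (hGω w hw).symm
  -- The chain rule gives `z₀ h' = m ω G'(ω) = m (φ(ω) - 1)`, so `φ(ω) - 1` is `φ(v) - 1` contracted
  -- by `m⁻¹`.
  refine le_trans (norm_le_norm_of_contraction hΩ hφ (t := m⁻¹) (by positivity)
    (inv_le_one_of_one_le₀ hm) (hmaps hz₀s) hv ?_) hvz
  have hm0 : (m : ℂ) ≠ 0 := by exact_mod_cast (by linarith : m ≠ 0)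
  rw [← hveq, hchain, ← hG' _ (hmaps hz₀s), ofReal_inv]
  field_simp
  linear_combination (-deriv G (ω z₀)) * hmeq

/-! ### Lifting through a locally injective holomorphic map. -/

section Lifting

variable {U K : Set ℂ} {G h : ℂ → ℂ}

theorem hasStrictDerivAt_of_differentiableOn (hU : IsOpen U) (hG : DifferentiableOn ℂ G U) {w : ℂ}
    (hw : w ∈ U) : HasStrictDerivAt G (deriv G w) w :=
  (hG.analyticAt (hU.mem_nhds hw)).hasStrictDerivAt

theorem exists_uniform_injOn_ball (hU : IsOpen U) (hG : DifferentiableOn ℂ G U)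
    (hG0 : ∀ z ∈ U, deriv G z ≠ 0) (hK : IsCompact K) (hKU : K ⊆ U) :
    ∃ δ > 0, ∀ w ∈ K, ball w (2 * δ) ⊆ U ∧ InjOn G (ball w (2 * δ)) := by
  -- Radii `δ ≤ 0` give empty balls, so the full neighbourhood filter serves for the compactness
  -- argument; positivity is imposed afterwards.
  have key : ∀ᶠ δ : ℝ in 𝓝 0, ∀ w ∈ K, ball w (2 * δ) ⊆ U ∧ InjOn G (ball w (2 * δ)) := by
    refine hK.eventually_forall_of_forall_eventually fun w₀ hw₀ => ?_
    have hs := hasStrictDerivAt_of_differentiableOn hU hG (hKU hw₀)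
    obtain ⟨ε, hε, hb⟩ := Metric.eventually_nhds_iff_ball.1
      ((hs.eventually_left_inverse (hG0 _ (hKU hw₀))).and (hU.mem_nhds (hKU hw₀)))
    have hinj : InjOn G (ball w₀ ε) := LeftInvOn.injOn fun x hx => (hb x hx).1
    have h1 : ∀ᶠ z : ℝ × ℂ in 𝓝 (0, w₀), z.1 < ε / 4 :=
      continuous_fst.continuousAt.eventually_lt_const (by simpa using hε)
    have h2 : ∀ᶠ z : ℝ × ℂ in 𝓝 (0, w₀), z.2 ∈ ball w₀ (ε / 4) :=
      continuous_snd.continuousAt.eventually_mem (ball_mem_nhds _ (by positivity))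
    filter_upwards [h1, h2] with z hz1 hz2
    have hsub : ball z.2 (2 * z.1) ⊆ ball w₀ ε :=
      ball_subset_ball' (by rw [mem_ball] at hz2; linarith)
    exact ⟨fun x hx => (hb x (hsub hx)).2, hinj.mono hsub⟩
  obtain ⟨δ, hδ, hpos⟩ := ((key.filter_mono nhdsWithin_le_nhds).and
    (self_mem_nhdsWithin : Ioi (0 : ℝ) ∈ 𝓝[>] 0)).exists
  exact ⟨δ, hpos, hδ⟩

theorem exists_uniform_ball_subset_image (hU : IsOpen U) (hG : DifferentiableOn ℂ G U)
    (hG0 : ∀ z ∈ U, deriv G z ≠ 0) (hK : IsCompact K) (hKU : K ⊆ U) {δ : ℝ} (hδ : 0 < δ) :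
    ∃ η > 0, ∀ w ∈ K, ball (G w) η ⊆ G '' ball w δ := by
  have key : ∀ᶠ η : ℝ in 𝓝 0, ∀ w ∈ K, ball (G w) η ⊆ G '' ball w δ := by
    refine hK.eventually_forall_of_forall_eventually fun w₀ hw₀ => ?_
    have hs := hasStrictDerivAt_of_differentiableOn hU hG (hKU hw₀)
    have hmem : G '' ball w₀ (δ / 2) ∈ 𝓝 (G w₀) := by
      rw [← hs.map_nhds_eq (hG0 _ (hKU hw₀))]
      exact image_mem_map (ball_mem_nhds _ (by positivity))
    obtain ⟨ε, hε, hb⟩ := Metric.mem_nhds_iff.1 hmem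
    have h1 : ∀ᶠ z : ℝ × ℂ in 𝓝 (0, w₀), z.1 < ε / 2 :=
      continuous_fst.continuousAt.eventually_lt_const (by simpa using hε)
    have h2 : ∀ᶠ z : ℝ × ℂ in 𝓝 (0, w₀), z.2 ∈ ball w₀ (δ / 2) :=
      continuous_snd.continuousAt.eventually_mem (ball_mem_nhds _ (by positivity))
    have h3 : ∀ᶠ z : ℝ × ℂ in 𝓝 (0, w₀), G z.2 ∈ ball (G w₀) (ε / 2) :=
      (ContinuousAt.comp (f := Prod.snd) (x := ((0 : ℝ), w₀)) hs.hasDerivAt.continuousAt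
        continuous_snd.continuousAt).eventually_mem (ball_mem_nhds _ (by positivity))
    filter_upwards [h1, h2, h3] with z hz1 hz2 hz3
    calc ball (G z.2) z.1 ⊆ ball (G w₀) ε :=
          ball_subset_ball' (by rw [mem_ball] at hz3; linarith)
      _ ⊆ G '' ball w₀ (δ / 2) := hb
      _ ⊆ G '' ball z.2 δ := image_mono
          (ball_subset_ball' (by rw [mem_ball, dist_comm] at hz2; linarith))
  obtain ⟨η, hη, hpos⟩ := ((key.filter_mono nhdsWithin_le_nhds).and
    (self_mem_nhdsWithin : Ioi (0 : ℝ) ∈ 𝓝[>] 0)).exists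
  exact ⟨η, hpos, hη⟩

/-- Lifting of `h` through `G` near a continuous approximate lift `a`. -/
theorem exists_lift_near (hU : IsOpen U) (hG : DifferentiableOn ℂ G U)
    (hG0 : ∀ z ∈ U, deriv G z ≠ 0) {δ η : ℝ} (hδ : 0 < δ)
    (hinj : ∀ w ∈ K, ball w (2 * δ) ⊆ U ∧ InjOn G (ball w (2 * δ)))
    (hsurj : ∀ w ∈ K, ball (G w) η ⊆ G '' ball w δ) {V : Set ℂ} (hV : IsOpen V)
    (hh : DifferentiableOn ℂ h V) {a : ℂ → ℂ} (ha : ContinuousOn a V) (haK : MapsTo a V K)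
    (hclose : ∀ z ∈ V, dist (h z) (G (a z)) < η) :
    ∃ ω : ℂ → ℂ, DifferentiableOn ℂ ω V ∧ ∀ z ∈ V, ω z ∈ ball (a z) δ ∧ G (ω z) = h z := by
  have hex : ∀ z ∈ V, ∃ w, w ∈ ball (a z) δ ∧ G w = h z := fun z hz =>
    hsurj _ (haK hz) (mem_ball.2 (hclose z hz))
  choose! ω hω using hex
  refine ⟨ω, fun z₁ hz₁ => DifferentiableAt.differentiableWithinAt ?_, hω⟩
  obtain ⟨hmem, heq⟩ := hω z₁ hz₁
  have hsub : ball (a z₁) δ ⊆ ball (a z₁) (2 * δ) := ball_subset_ball (by linarith)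
  have hωU : ω z₁ ∈ U := (hinj _ (haK hz₁)).1 (hsub hmem)
  have hs := hasStrictDerivAt_of_differentiableOn hU hG hωU
  set Ψ := hs.localInverse _ _ _ (hG0 _ hωU)
  have hΨ : HasStrictDerivAt Ψ (deriv G (ω z₁))⁻¹ (h z₁) := heq ▸ hs.to_localInverse (hG0 _ hωU)
  have hΨr : ∀ᶠ y in 𝓝 (h z₁), G (Ψ y) = y := heq ▸ hs.eventually_right_inverse (hG0 _ hωU)
  have hΨ1 : Ψ (h z₁) = ω z₁ := by
    rw [← heq]
    exact (hs.eventually_left_inverse (hG0 _ hωU)).self_of_nhds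
  have hhd := hh.differentiableAt (hV.mem_nhds hz₁)
  have hcomp : DifferentiableAt ℂ (fun z => Ψ (h z)) z₁ :=
    hΨ.hasDerivAt.differentiableAt.comp z₁ hhd
  refine hcomp.congr_of_eventuallyEq ?_
  have h1 : ∀ᶠ z in 𝓝 z₁, a z ∈ ball (a z₁) δ :=
    (ha.continuousAt (hV.mem_nhds hz₁)).eventually_mem (ball_mem_nhds _ hδ)
  have h2 : ∀ᶠ z in 𝓝 z₁, Ψ (h z) ∈ ball (a z₁) (2 * δ) :=
    hcomp.continuousAt.eventually_mem (isOpen_ball.mem_nhds (by rw [hΨ1]; exact hsub hmem))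
  filter_upwards [h1, h2, hV.mem_nhds hz₁, hhd.continuousAt.eventually hΨr] with z hz1 hz2 hzV hz3
  -- The radius `2 * δ` absorbs the movement of the centre `a z`: the chosen lift and the local
  -- inverse branch lie in one injectivity ball, hence coincide.
  refine (hinj _ (haK hz₁)).2 (ball_subset_ball' ?_ (hω z hzV).1) hz2 ?_
  · rw [mem_ball] at hz1
    linarith
  · rw [(hω z hzV).2, hz3]

end Lifting

/-! ### Subordination of the logarithms of the derivatives. -/

/-- A lift on a small disk is enlarged by a fixed factor at each step. The bound of
`norm_le_of_comp_eq` keeps every lift inside the compact disk of radius `R`, where the lifting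
constants `δ` and `η` are uniform, so finitely many steps suffice. -/
theorem exists_subordination {Ω : Set ℂ} (hΩ : StarConvex ℝ (1 : ℂ) Ω) {φ G h : ℂ → ℂ} {R : ℝ}
    (hR0 : 0 < R) (hR1 : R < 1)
    (hφ : IsNormalizedConformalMap φ Ω) (hG : DifferentiableOn ℂ G unitDisk) (hGz : G 0 = 0)
    (hG0 : ∀ z ∈ unitDisk, deriv G z ≠ 0) (hG' : ∀ z ∈ unitDisk, z * deriv G z = φ z - 1)
    (hhd : DifferentiableOn ℂ h unitDisk) (hhz : h 0 = 0)
    (hh : ∀ z ∈ unitDisk, ∃ v ∈ unitDisk, ‖v‖ ≤ ‖z‖ ∧ z * deriv h z = φ v - 1) :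
    ∃ ω : ℂ → ℂ, DifferentiableOn ℂ ω (ball 0 R) ∧ ω 0 = 0 ∧
      ∀ z ∈ ball (0 : ℂ) R, ‖ω z‖ ≤ ‖z‖ ∧ G (ω z) = h z := by
  have hKU : closedBall (0 : ℂ) R ⊆ unitDisk := closedBall_subset_ball hR1
  have hK := isCompact_closedBall (0 : ℂ) R
  have h0K : (0 : ℂ) ∈ closedBall (0 : ℂ) R := mem_closedBall_self hR0.le
  obtain ⟨δ, hδ, hinj⟩ := exists_uniform_injOn_ball isOpen_ball hG hG0 hK hKU
  obtain ⟨η, hη, hsurj⟩ := exists_uniform_ball_subset_image isOpen_ball hG hG0 hK hKU hδ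
  have lift : ∀ s ≤ R, 0 < s → ∀ a : ℂ → ℂ, ContinuousOn a (ball 0 s) →
      (∀ z ∈ ball (0 : ℂ) s, ‖a z‖ ≤ R) → a 0 = 0 →
      (∀ z ∈ ball (0 : ℂ) s, dist (h z) (G (a z)) < η) →
      ∃ ω : ℂ → ℂ, DifferentiableOn ℂ ω (ball 0 s) ∧ ω 0 = 0 ∧
        ∀ z ∈ ball (0 : ℂ) s, ‖ω z‖ ≤ ‖z‖ ∧ G (ω z) = h z := by
    intro s hsR hs0 a ha haR ha0 hclose
    have hsU : ball (0 : ℂ) s ⊆ unitDisk := ball_subset_ball (hsR.trans hR1.le)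
    have h0s : (0 : ℂ) ∈ ball (0 : ℂ) s := mem_ball_self hs0
    have haK : MapsTo a (ball 0 s) (closedBall 0 R) := fun z hz => by simpa using haR z hz
    obtain ⟨ω, hωd, hω⟩ := exists_lift_near isOpen_ball hG hG0 hδ hinj hsurj isOpen_ball
      (hhd.mono hsU) ha haK hclose
    have hsub : ∀ w : ℂ, ball w δ ⊆ ball w (2 * δ) := fun w => ball_subset_ball (by linarith)
    have hω0 : ω 0 = 0 := by
      obtain ⟨h1, h2⟩ := hω 0 h0s
      rw [ha0] at h1
      exact (hinj 0 h0K).2 (hsub _ h1) (mem_ball_self (by positivity)) (by rw [h2, hhz, hGz])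
    have hmaps : MapsTo ω (ball 0 s) unitDisk := fun z hz =>
      (hinj _ (haK hz)).1 (hsub _ (hω z hz).1)
    exact ⟨ω, hωd, hω0, fun z hz => ⟨norm_le_of_comp_eq hΩ hφ hG hG' (fun z hz => hh z (hsU hz))
      hωd hmaps hω0 (fun z hz => (hω z hz).2) hz, (hω z hz).2⟩⟩
  -- By uniform continuity, a dilation by `c` close to `1` moves `h` by less than `η`.
  obtain ⟨c, hc0, hc1, hc⟩ : ∃ c : ℝ, 0 < c ∧ c < 1 ∧
      ∀ z ∈ closedBall (0 : ℂ) R, dist (h z) (h (c * z)) < η := by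
    obtain ⟨κ, hκ, hu⟩ := Metric.uniformContinuousOn_iff.1
      (hK.uniformContinuousOn_of_continuous (hhd.mono hKU).continuousOn) η hη
    have hm : 0 < min κ 1 := lt_min hκ one_pos
    have hm1 : min κ 1 ≤ 1 := min_le_right _ _
    refine ⟨1 - min κ 1 / 2, by linarith, by linarith, fun z hz => ?_⟩
    have hz' : ‖z‖ ≤ R := by simpa using hz
    refine hu z hz _ ?_ ?_
    · rw [mem_closedBall_zero_iff, norm_mul, norm_real, Real.norm_eq_abs, abs_of_pos (by linarith)]
      nlinarith [norm_nonneg z]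
    · have : z - ((1 - min κ 1 / 2 : ℝ) : ℂ) * z = ((min κ 1 / 2 : ℝ) : ℂ) * z := by
        push_cast
        ring
      rw [dist_eq_norm, this, norm_mul, norm_real, Real.norm_eq_abs, abs_of_pos (by positivity)]
      calc min κ 1 / 2 * ‖z‖ ≤ min κ 1 / 2 * 1 := by gcongr; linarith
        _ < κ := by linarith [min_le_left κ 1]
  obtain ⟨ρ, hρ, hbase⟩ : ∃ ρ > 0, ∀ z ∈ ball (0 : ℂ) ρ, dist (h z) (G 0) < η := by
    have h1 : ContinuousAt h 0 := (hhd.differentiableAt (isOpen_ball.mem_nhds (hKU h0K))).continuousAt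
    obtain ⟨ρ, hρ, hb⟩ := Metric.continuousAt_iff.1 h1 η hη
    exact ⟨ρ, hρ, fun z hz => by rw [hGz, ← hhz]; exact hb hz⟩
  have step : ∀ n : ℕ, ∃ ω : ℂ → ℂ, DifferentiableOn ℂ ω (ball 0 (min R (ρ / c ^ n))) ∧ ω 0 = 0 ∧
      ∀ z ∈ ball (0 : ℂ) (min R (ρ / c ^ n)), ‖ω z‖ ≤ ‖z‖ ∧ G (ω z) = h z := by
    intro n
    induction n with
    | zero =>
      refine lift _ (min_le_left _ _) (lt_min hR0 (by positivity)) (fun _ => (0 : ℂ)) continuousOn_const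
        (fun z hz => by simpa using hR0.le) rfl (fun z hz => hbase z ?_)
      simp at hz ⊢
      exact hz.2
    | succ n ih =>
      obtain ⟨ω, hωd, hω0, hω⟩ := ih
      have hm : MapsTo (fun z : ℂ => (c : ℂ) * z) (ball 0 (min R (ρ / c ^ (n + 1))))
          (ball 0 (min R (ρ / c ^ n))) := by
        intro z hz
        rw [mem_ball_zero_iff, lt_min_iff] at hz
        rw [mem_ball_zero_iff, lt_min_iff, norm_mul, norm_real, Real.norm_eq_abs, abs_of_pos hc0]
        constructor
        · nlinarith [norm_nonneg z]
        · calc c * ‖z‖ < c * (ρ / c ^ (n + 1)) := by gcongr; exact hz.2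
            _ = ρ / c ^ n := by field_simp; ring
      -- The dilate `ω (c z)` lives on the larger disk and is an approximate lift, since `G (ω (c
      -- z)) = h (c z)`.
      refine lift _ (min_le_left _ _) (lt_min hR0 (by positivity)) (fun z => ω (c * z)) ?_ ?_ ?_ ?_
      · exact hωd.continuousOn.comp (by fun_prop) hm
      · intro z hz
        refine (hω _ (hm hz)).1.trans ?_
        have := hm hz
        rw [mem_ball_zero_iff, lt_min_iff] at this
        exact this.1.le
      · simpa using hω0
      · intro z hz
        rw [(hω _ (hm hz)).2]
        refine hc z ?_
        rw [mem_ball_zero_iff, lt_min_iff] at hz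
        simpa using hz.1.le
  obtain ⟨n, hn⟩ := exists_pow_lt_of_lt_one (div_pos hρ hR0) hc1
  have hmin : min R (ρ / c ^ n) = R := by
    refine min_eq_left ?_
    rw [lt_div_iff₀ hR0] at hn
    rw [le_div_iff₀ (by positivity)]
    linarith
  simpa only [hmin] using step n

/-! ### Littlewood's subordination theorem for mean squares, with strictness. -/

section Littlewood

/-- The mean of `‖u‖ ^ 2` over the circle of radius `r` about the origin. -/
noncomputable def meanSq (u : ℂ → ℂ) (r : ℝ) : ℝ := Real.circleAverage (fun z => ‖u z‖ ^ 2) 0 r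

variable {u Q ω : ℂ → ℂ} {r ρ : ℝ}

theorem circleIntegrable_of_continuousOn_ball {E : Type*} [NormedAddCommGroup E] {v : ℂ → E}
    (hr : 0 < r) (hrρ : r < ρ) (hv : ContinuousOn v (ball 0 ρ)) : CircleIntegrable v 0 r :=
  (hv.mono (sphere_subset_closedBall.trans (closedBall_subset_ball hrρ))).circleIntegrable hr.le

theorem norm_eq_of_mem_sphere_abs (hr : 0 < r) {z : ℂ} (hz : z ∈ sphere (0 : ℂ) |r|) :
    ‖z‖ = r := by
  simpa [abs_of_pos hr] using hz

theorem meanSq_nonneg (u : ℂ → ℂ) (r : ℝ) : 0 ≤ meanSq u r :=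
  Real.circleAverage_nonneg_of_nonneg fun _ _ => by positivity

theorem diffContOnCl_of_differentiableOn_ball (hr : 0 < r) (hrρ : r < ρ)
    (hu : DifferentiableOn ℂ u (ball 0 ρ)) : DiffContOnCl ℂ u (ball 0 |r|) := by
  rw [abs_of_pos hr]
  exact (hu.mono (closedBall_subset_ball hrρ)).diffContOnCl_ball subset_rfl

/-- The cross term is the real part of a holomorphic function vanishing at `0`, so its circle
average is zero. -/
theorem meanSq_eq_add (hr : 0 < r) (hrρ : r < ρ) (hu : DifferentiableOn ℂ u (ball 0 ρ)) :
    meanSq u r = ‖u 0‖ ^ 2 + Real.circleAverage (fun z => ‖u z - u 0‖ ^ 2) 0 r := by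
  have hcont : ContinuousOn (fun z => (starRingEnd ℂ) (u 0) * (u z - u 0)) (ball 0 ρ) :=
    continuousOn_const.mul (hu.continuousOn.sub continuousOn_const)
  have hzero : Real.circleAverage (fun z => reCLM ((starRingEnd ℂ) (u 0) * (u z - u 0))) 0 r = 0 := by
    have h1 := reCLM.circleAverage_comp_comm (f := fun z => (starRingEnd ℂ) (u 0) * (u z - u 0))
      (circleIntegrable_of_continuousOn_ball hr hrρ hcont)
    have h2 := DiffContOnCl.circleAverage (f := fun z => (starRingEnd ℂ) (u 0) * (u z - u 0))
      (diffContOnCl_of_differentiableOn_ball hr hrρ ((hu.sub_const _).const_mul _))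
    rw [h2] at h1
    simpa [Function.comp_def] using h1
  have hsplit : (fun z => ‖u z‖ ^ 2) = (fun z => (‖u 0‖ ^ 2 + ‖u z - u 0‖ ^ 2) +
      (2 : ℝ) • reCLM ((starRingEnd ℂ) (u 0) * (u z - u 0))) := by
    funext z
    simp only [← normSq_eq_norm_sq, normSq_apply]
    simp
    ring
  have hI1 : CircleIntegrable (fun z => ‖u z - u 0‖ ^ 2) 0 r :=
    circleIntegrable_of_continuousOn_ball hr hrρ
      ((hu.continuousOn.sub continuousOn_const).norm.pow 2)
  have hI2 : CircleIntegrable (fun z => ‖u 0‖ ^ 2 + ‖u z - u 0‖ ^ 2) 0 r :=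
    (circleIntegrable_const _ _ _).add hI1
  have hI3 : CircleIntegrable
      (fun z => (2 : ℝ) • reCLM ((starRingEnd ℂ) (u 0) * (u z - u 0))) 0 r :=
    circleIntegrable_of_continuousOn_ball hr hrρ
      ((reCLM.continuous.comp_continuousOn hcont).const_smul (2 : ℝ))
  rw [meanSq, hsplit, Real.circleAverage_fun_add hI2 hI3,
    Real.circleAverage_fun_add (circleIntegrable_const _ _ _) hI1, Real.circleAverage_const,
    Real.circleAverage_fun_smul, hzero]
  simp

theorem sq_norm_le_meanSq (hr : 0 < r) (hrρ : r < ρ) (hu : DifferentiableOn ℂ u (ball 0 ρ)) :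
    ‖u 0‖ ^ 2 ≤ meanSq u r := by
  rw [meanSq_eq_add hr hrρ hu]
  exact le_add_of_nonneg_right (Real.circleAverage_nonneg_of_nonneg fun _ _ => by positivity)

theorem differentiableOn_dslope_ball (hρ : 0 < ρ) (hQ : DifferentiableOn ℂ Q (ball 0 ρ)) :
    DifferentiableOn ℂ (dslope Q 0) (ball 0 ρ) :=
  (differentiableOn_dslope (ball_mem_nhds 0 hρ)).2 hQ

theorem sub_eq_mul_dslope (Q : ℂ → ℂ) (z : ℂ) : Q z - Q 0 = z * dslope Q 0 z := by
  simpa using (sub_smul_dslope Q 0 z).symm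

theorem meanSq_eq_add_dslope (hr : 0 < r) (hrρ : r < ρ) (hQ : DifferentiableOn ℂ Q (ball 0 ρ)) :
    meanSq Q r = ‖Q 0‖ ^ 2 + r ^ 2 * meanSq (dslope Q 0) r := by
  rw [meanSq_eq_add hr hrρ hQ, meanSq, ← smul_eq_mul, ← Real.circleAverage_fun_smul]
  congr 1
  refine Real.circleAverage_congr_sphere fun z hz => ?_
  simp only [smul_eq_mul]
  rw [sub_eq_mul_dslope, norm_mul, mul_pow, norm_eq_of_mem_sphere_abs hr hz]

theorem meanSq_comp_le_of_norm_le {q : ℝ} (hr : 0 < r) (hrρ : r < ρ)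
    (hQ : DifferentiableOn ℂ Q (ball 0 ρ)) (hω : DifferentiableOn ℂ ω (ball 0 ρ))
    (hle : ∀ z ∈ ball (0 : ℂ) ρ, ‖ω z‖ ≤ ‖z‖) (hq : ∀ z ∈ sphere (0 : ℂ) r, ‖ω z‖ ≤ q) :
    meanSq (fun z => Q (ω z)) r ≤ ‖Q 0‖ ^ 2 + q ^ 2 * meanSq (fun z => dslope Q 0 (ω z)) r := by
  have hρ : 0 < ρ := hr.trans hrρ
  have hmaps : MapsTo ω (ball 0 ρ) (ball 0 ρ) := fun z hz => by
    rw [mem_ball_zero_iff] at hz ⊢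
    exact (hle z (mem_ball_zero_iff.2 hz)).trans_lt hz
  have hω0 : ω 0 = 0 := by simpa using hle 0 (mem_ball_self hρ)
  have hD := differentiableOn_dslope_ball hρ hQ
  rw [meanSq_eq_add (u := fun z => Q (ω z)) hr hrρ (hQ.comp hω hmaps), hω0, meanSq, ← smul_eq_mul,
    ← Real.circleAverage_fun_smul]
  refine add_le_add_right (Real.circleAverage_mono ?_ ?_ fun z hz => ?_) _
  · exact circleIntegrable_of_continuousOn_ball hr hrρ
      (((hQ.comp hω hmaps).continuousOn.sub continuousOn_const).norm.pow 2)
  · exact circleIntegrable_of_continuousOn_ball hr hrρ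
      (((hD.comp hω hmaps).continuousOn.norm.pow 2).const_smul (q ^ 2))
  · rw [abs_of_pos hr] at hz
    rw [sub_eq_mul_dslope, norm_mul, mul_pow, smul_eq_mul]
    have := hq z hz
    gcongr

/-- Cauchy's formula for `Q ^ 2` on the circle of radius `R`, where the kernel is at most `R / (R -
r)` in modulus. -/
theorem sq_norm_le_mul_meanSq {R : ℝ} (hr : 0 < r) (hrR : r < R) (hRρ : R < ρ)
    (hQ : DifferentiableOn ℂ Q (ball 0 ρ)) {w : ℂ} (hw : ‖w‖ ≤ r) :
    ‖Q w‖ ^ 2 ≤ R / (R - r) * meanSq Q R := by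
  have hR : 0 < R := hr.trans hrR
  have hne : ∀ z ∈ sphere (0 : ℂ) |R|, R - r ≤ ‖z - w‖ := fun z hz => by
    have h1 := norm_sub_norm_le z w
    rw [norm_eq_of_mem_sphere_abs hR hz] at h1
    linarith
  have h1 := DiffContOnCl.circleAverage_smul_div (f := fun z => Q z ^ 2) (c := 0) (R := R) (w := w)
    (diffContOnCl_of_differentiableOn_ball hR hRρ (hQ.pow 2))
    (by simpa [abs_of_pos hR] using hw.trans_lt hrR)
  rw [← norm_pow, ← h1, meanSq, ← smul_eq_mul, ← Real.circleAverage_fun_smul]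
  have hcs : ContinuousOn (fun z => Q z) (sphere 0 |R|) := by
    rw [abs_of_pos hR]
    exact hQ.continuousOn.mono (sphere_subset_closedBall.trans (closedBall_subset_ball hRρ))
  calc ‖Real.circleAverage (fun z => ((z - 0) / (z - w)) • Q z ^ 2) 0 R‖
      ≤ Real.circleAverage (fun z => ‖((z - 0) / (z - w)) • Q z ^ 2‖) 0 R := by
        rw [Real.circleAverage, Real.circleAverage, norm_smul, smul_eq_mul, Real.norm_eq_abs,
          abs_of_pos (by positivity)]
        gcongr
        exact intervalIntegral.norm_integral_le_integral_norm Real.two_pi_pos.le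
    _ ≤ _ := by
        refine Real.circleAverage_mono ?_ ?_ fun z hz => ?_
        · refine ContinuousOn.circleIntegrable' (ContinuousOn.norm
            (ContinuousOn.fun_smul ?_ (hcs.fun_pow 2)))
          refine ContinuousOn.div (by fun_prop) (by fun_prop) fun z hz => ?_
          have := hne z hz
          exact norm_pos_iff.1 (by linarith)
        · exact ContinuousOn.circleIntegrable' ((hcs.norm.pow 2).const_smul (R / (R - r)))
        · have h2 := hne z hz
          have h3 : 0 < R - r := sub_pos.2 hrR
          rw [norm_smul, norm_div, sub_zero, norm_eq_of_mem_sphere_abs hR hz, norm_pow, smul_eq_mul]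
          gcongr

/-- **Littlewood's subordination theorem** for the mean square. -/
theorem meanSq_comp_le (hr : 0 < r) (hrρ : r < ρ)
    (hQ : DifferentiableOn ℂ Q (ball 0 ρ)) (hω : DifferentiableOn ℂ ω (ball 0 ρ))
    (hle : ∀ z ∈ ball (0 : ℂ) ρ, ‖ω z‖ ≤ ‖z‖) :
    meanSq (fun z => Q (ω z)) r ≤ meanSq Q r := by
  have hρ : 0 < ρ := hr.trans hrρ
  obtain ⟨R, hrR, hRρ⟩ := exists_between hrρ
  have hR : 0 < R := hr.trans hrR
  -- `B n` is the `n`-th Taylor tail of `Q` divided by `zⁿ`.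
  set B : ℕ → ℂ → ℂ := fun n => (fun P => dslope P 0)^[n] Q with hB
  have hBs : ∀ n, B (n + 1) = dslope (B n) 0 := fun n => by
    simp only [hB, Function.iterate_succ_apply']
  have hBd : ∀ n, DifferentiableOn ℂ (B n) (ball 0 ρ) := by
    intro n
    induction n with
    | zero => exact hQ
    | succ n ih => rw [hBs]; exact differentiableOn_dslope_ball hρ ih
  have hωr : ∀ z ∈ sphere (0 : ℂ) r, ‖ω z‖ ≤ r := fun z hz => by
    have hz' : ‖z‖ = r := by simpa using hz
    rw [← hz']
    exact hle z (by simpa [hz'] using hrρ)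
  have hωmaps : MapsTo ω (ball 0 ρ) (ball 0 ρ) := fun z hz => by
    rw [mem_ball_zero_iff] at hz ⊢
    exact (hle z (mem_ball_zero_iff.2 hz)).trans_lt hz
  -- Splitting off the constant term costs `r ^ 2` exactly for `B n` and at most `r ^ 2` for `B n ∘
  -- ω`, so the constants cancel.
  have hgap : ∀ n, r ^ (2 * n) * (meanSq (B n) r - meanSq (fun z => B n (ω z)) r) ≤
      meanSq Q r - meanSq (fun z => Q (ω z)) r := by
    intro n
    induction n with
    | zero => simp [hB]
    | succ n ih =>
      refine le_trans ?_ ih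
      have h1 := meanSq_eq_add_dslope hr hrρ (hBd n)
      have h2 := meanSq_comp_le_of_norm_le hr hrρ (hBd n) hω hle hωr
      rw [← hBs] at h1 h2
      calc _ = r ^ (2 * n) *
            (r ^ 2 * meanSq (B (n + 1)) r - r ^ 2 * meanSq (fun z => B (n + 1) (ω z)) r) := by ring
        _ ≤ _ := by gcongr ?_ * ?_; linarith
  have hMR : ∀ n, R ^ (2 * n) * meanSq (B n) R ≤ meanSq Q R := by
    intro n
    induction n with
    | zero => simp [hB]
    | succ n ih =>
      refine le_trans ?_ ih
      have h1 := meanSq_eq_add_dslope hR hRρ (hBd n)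
      rw [← hBs] at h1
      calc _ = R ^ (2 * n) * (R ^ 2 * meanSq (B (n + 1)) R) := by ring
        _ ≤ _ := by gcongr ?_ * ?_; nlinarith [sq_nonneg ‖B n 0‖]
  -- The larger radius `R` supplies the geometric decay `(r / R) ^ (2 n)`.
  have htail : ∀ n, r ^ (2 * n) * meanSq (fun z => B n (ω z)) r ≤
      R / (R - r) * meanSq Q R * ((r / R) ^ 2) ^ n := by
    intro n
    have h1 : meanSq (fun z => B n (ω z)) r ≤ R / (R - r) * meanSq (B n) R := by
      refine Real.circleAverage_mono_on_of_le_circle ?_ fun z hz => ?_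
      · exact circleIntegrable_of_continuousOn_ball hr hrρ
          (((hBd n).comp hω hωmaps).continuousOn.norm.pow 2)
      · rw [abs_of_pos hr] at hz
        exact sq_norm_le_mul_meanSq hr hrR hRρ (hBd n) (hωr z hz)
    have h3 : 0 < R - r := sub_pos.2 hrR
    calc _ ≤ r ^ (2 * n) * (R / (R - r) * meanSq (B n) R) := by gcongr
      _ = R / (R - r) * (R ^ (2 * n) * meanSq (B n) R) * ((r / R) ^ 2) ^ n := by
        rw [← pow_mul, div_pow]
        field_simp
      _ ≤ _ := by gcongr; exact hMR n
  have hlim : Tendsto (fun n : ℕ => R / (R - r) * meanSq Q R * ((r / R) ^ 2) ^ n) atTop (𝓝 0) := by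
    rw [← mul_zero (R / (R - r) * meanSq Q R)]
    refine (tendsto_pow_atTop_nhds_zero_of_lt_one (by positivity) ?_).const_mul _
    have : r / R < 1 := (div_lt_one hR).2 hrR
    exact pow_lt_one₀ (by positivity) this two_ne_zero
  have hlim' := hlim.neg
  rw [neg_zero] at hlim'
  refine sub_nonneg.1 (le_of_tendsto' hlim' fun n => ?_)
  have h1 := hgap n
  have h2 := htail n
  have h3 : 0 ≤ r ^ (2 * n) * meanSq (B n) r := mul_nonneg (by positivity) (meanSq_nonneg _ _)
  rw [mul_sub] at h1
  linarith

/-- With `q < r` the maximum of `‖ω‖` on the circle, the non-constant part carries the factor `q ^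
2` instead of `r ^ 2`, and its mean square is at least `‖Q' 0‖ ^ 2 > 0`. -/
theorem meanSq_comp_lt (hr : 0 < r) (hrρ : r < ρ)
    (hQ : DifferentiableOn ℂ Q (ball 0 ρ)) (hω : DifferentiableOn ℂ ω (ball 0 ρ))
    (hle : ∀ z ∈ ball (0 : ℂ) ρ, ‖ω z‖ ≤ ‖z‖) (hlt : ∀ z ∈ sphere (0 : ℂ) r, ‖ω z‖ < r)
    (hQ' : deriv Q 0 ≠ 0) :
    meanSq (fun z => Q (ω z)) r < meanSq Q r := by
  have hρ : 0 < ρ := hr.trans hrρ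
  have hD := differentiableOn_dslope_ball hρ hQ
  obtain ⟨z₁, hz₁, hmax⟩ := (isCompact_sphere (0 : ℂ) r).exists_isMaxOn
    (NormedSpace.sphere_nonempty.2 hr.le)
    ((hω.continuousOn.mono (sphere_subset_closedBall.trans (closedBall_subset_ball hrρ))).norm)
  have h1 := meanSq_comp_le_of_norm_le hr hrρ hQ hω hle (q := ‖ω z₁‖) fun z hz => hmax hz
  have h2 := meanSq_comp_le hr hrρ hD hω hle
  have h3 := sq_norm_le_meanSq hr hrρ hD
  rw [dslope_same] at h3
  have h4 : 0 < ‖deriv Q 0‖ ^ 2 := by positivity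
  have h5 : ‖ω z₁‖ ^ 2 < r ^ 2 := by have := hlt z₁ hz₁; gcongr
  have h6 := meanSq_eq_add_dslope hr hrρ hQ
  have h7 : ‖ω z₁‖ ^ 2 * meanSq (fun z => dslope Q 0 (ω z)) r ≤
      ‖ω z₁‖ ^ 2 * meanSq (dslope Q 0) r := by gcongr
  nlinarith

end Littlewood

/-! ### Segment integrals and logarithms of derivatives. -/

theorem smul_mem_unitDisk {z : ℂ} (hz : z ∈ unitDisk) {s : ℝ} (hs : s ∈ uIcc (0 : ℝ) 1) :
    (s : ℂ) * z ∈ unitDisk := by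
  rw [uIcc_of_le zero_le_one] at hs
  rw [unitDisk, mem_ball_zero_iff] at hz ⊢
  rw [norm_mul, norm_real, Real.norm_eq_abs, abs_of_nonneg hs.1]
  nlinarith [norm_nonneg z, hs.1, hs.2]

theorem segmentIntegral_eq_sub {g P : ℂ → ℂ} (hg : ContinuousOn g unitDisk)
    (hP : ∀ z ∈ unitDisk, HasDerivAt P (g z) z) {z : ℂ} (hz : z ∈ unitDisk) :
    segmentIntegral g z = P z - P 0 := by
  have hder : ∀ s ∈ uIcc (0 : ℝ) 1, HasDerivAt (fun s : ℝ => P ((s : ℂ) * z))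
      (g ((s : ℂ) * z) * z) s := fun s hs => by
    have h1 : HasDerivAt (fun s : ℝ => (s : ℂ) * z) z s := by
      simpa using (ofRealCLM.hasDerivAt (x := s)).mul_const z
    exact (hP _ (smul_mem_unitDisk hz hs)).comp s h1
  have hint : IntervalIntegrable (fun s : ℝ => g ((s : ℂ) * z) * z) MeasureTheory.volume 0 1 :=
    ((hg.comp (by fun_prop) fun s hs => smul_mem_unitDisk hz hs).mul
      continuousOn_const).intervalIntegrable
  simpa [segmentIntegral] using intervalIntegral.integral_eq_sub_of_hasDerivAt hder hint

theorem segmentIntegral_congr {g₁ g₂ : ℂ → ℂ} (h : ∀ z ∈ unitDisk, z ≠ 0 → g₁ z = g₂ z) {z : ℂ}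
    (hz : z ∈ unitDisk) : segmentIntegral g₁ z = segmentIntegral g₂ z := by
  refine intervalIntegral.integral_congr_ae (Eventually.of_forall fun s hs => ?_)
  rcases eq_or_ne z 0 with rfl | hz0
  · simp
  · have hs0 : (s : ℂ) ≠ 0 := by
      rw [uIoc_of_le zero_le_one] at hs
      exact_mod_cast hs.1.ne'
    rw [h _ (smul_mem_unitDisk hz (uIoc_subset_uIcc hs)) (mul_ne_zero hs0 hz0)]

theorem exists_primitive {g : ℂ → ℂ} (hg : DifferentiableOn ℂ g unitDisk) :
    ∃ P : ℂ → ℂ, P 0 = 0 ∧ ∀ z ∈ unitDisk, HasDerivAt P (g z) z :=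
  hg.isExactOn_ball.with_val_at 0 0

/-- `log k'` for the extremal function `k`. -/
theorem exists_log_deriv_extremalFunction {φ : ℂ → ℂ} {Ω : Set ℂ}
    (hφ : IsNormalizedConformalMap φ Ω) :
    ∃ G : ℂ → ℂ, G 0 = 0 ∧ (∀ z ∈ unitDisk, HasDerivAt G (dslope φ 0 z) z) ∧
      ∀ z ∈ unitDisk, HasDerivAt (extremalFunction φ) (exp (G z)) z := by
  have h0 : (0 : ℂ) ∈ unitDisk := mem_ball_self one_pos
  have hd : DifferentiableOn ℂ (dslope φ 0) unitDisk :=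
    -- `dslope φ 0` is `(φ ζ - 1) / ζ` with the singularity at `0` removed.
    differentiableOn_dslope_ball one_pos hφ.holomorphic
  obtain ⟨G, hG0, hG⟩ := exists_primitive hd
  have hGd : DifferentiableOn ℂ G unitDisk := fun z hz =>
    (hG z hz).differentiableAt.differentiableWithinAt
  obtain ⟨K, hK0, hK⟩ := exists_primitive (g := fun z => exp (G z)) hGd.cexp
  have hinner : ∀ t ∈ unitDisk, segmentIntegral (fun ζ => (φ ζ - 1) / ζ) t = G t := fun t ht => by
    rw [segmentIntegral_congr (g₂ := dslope φ 0) _ ht, segmentIntegral_eq_sub hd.continuousOn hG ht,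
      hG0, sub_zero]
    intro z _ hz0
    rw [dslope_of_ne _ hz0, slope_def_field, hφ.map_zero, sub_zero]
  have hk : ∀ z ∈ unitDisk, extremalFunction φ z = K z := fun z hz => by
    rw [extremalFunction, segmentIntegral_congr (g₂ := fun z => exp (G z)) _ hz,
      segmentIntegral_eq_sub hGd.cexp.continuousOn hK hz, hK0, sub_zero]
    intro t ht _
    rw [hinner t ht]
  refine ⟨G, hG0, hG, fun z hz => (hK z hz).congr_of_eventuallyEq ?_⟩
  filter_upwards [isOpen_ball.mem_nhds hz] with w hw using hk w hw

theorem extremalFunction_zero (φ : ℂ → ℂ) : extremalFunction φ 0 = 0 := by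
  simp [extremalFunction, segmentIntegral]

theorem dslope_ne_zero_of_conformal {φ : ℂ → ℂ} {Ω : Set ℂ} (hφ : IsNormalizedConformalMap φ Ω)
    {z : ℂ} (hz : z ∈ unitDisk) : dslope φ 0 z ≠ 0 := by
  rcases eq_or_ne z 0 with rfl | hz0
  · rw [dslope_same]
    intro h
    have := hφ.deriv_re_pos
    simp [h] at this
  · intro h
    have h1 := sub_eq_mul_dslope φ z
    rw [h, mul_zero, sub_eq_zero] at h1
    exact hz0 (hφ.bijOn.injOn hz (mem_ball_self one_pos) h1)

/-- `log f'` for `f` in the class `ClassC Ω`. -/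
theorem exists_log_deriv_of_classC {φ f : ℂ → ℂ} {Ω : Set ℂ} (hφ : IsNormalizedConformalMap φ Ω)
    (hf : ClassC Ω f) :
    ∃ h : ℂ → ℂ, h 0 = 0 ∧ DifferentiableOn ℂ h unitDisk ∧ (∀ z ∈ unitDisk, deriv f z = exp (h z)) ∧
      ∀ z ∈ unitDisk, ∃ v ∈ unitDisk, ‖v‖ ≤ ‖z‖ ∧ z * deriv h z = φ v - 1 := by
  have h0 : (0 : ℂ) ∈ unitDisk := mem_ball_self one_pos
  have hf1 : DifferentiableOn ℂ (deriv f) unitDisk := hf.holomorphic.deriv isOpen_ball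
  have hf2 : DifferentiableOn ℂ (deriv (deriv f)) unitDisk := hf1.deriv isOpen_ball
  obtain ⟨h, hh0, hh⟩ := exists_primitive (hf2.div hf1 hf.deriv_ne_zero)
  have hhd : DifferentiableOn ℂ h unitDisk := fun z hz =>
    (hh z hz).differentiableAt.differentiableWithinAt
  refine ⟨h, hh0, hhd, fun z hz => ?_, fun z hz => ?_⟩
  · have hder : ∀ w ∈ unitDisk, HasDerivAt (fun w => deriv f w * exp (-h w)) 0 w := fun w hw => by
      have h1 := (hf1.differentiableAt (isOpen_ball.mem_nhds hw)).hasDerivAt.mul (hh w hw).neg.cexp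
      refine h1.congr_deriv ?_
      have := hf.deriv_ne_zero w hw
      simp only [Pi.div_apply, Pi.neg_apply]
      field_simp
      ring
    have hconst : deriv f z * exp (-h z) = deriv f 0 * exp (-h 0) :=
      isOpen_ball.is_const_of_deriv_eq_zero (convex_ball (0 : ℂ) 1).isPreconnected
        (fun w hw => (hder w hw).differentiableAt.differentiableWithinAt)
        (fun w hw => (hder w hw).deriv) hz h0
    rw [hf.deriv_zero, hh0, neg_zero, exp_zero, mul_one, exp_neg] at hconst
    exact eq_of_mul_inv_eq_one hconst
  · have hL : LeftInvOn (Function.invFunOn φ unitDisk) φ unitDisk :=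
      hφ.bijOn.injOn.leftInvOn_invFunOn
    have hd : DifferentiableOn ℂ (Function.invFunOn φ unitDisk) (φ '' unitDisk) :=
      differentiableOn_leftInverse isOpen_ball hφ.holomorphic hφ.bijOn.injOn hL
    rw [hφ.bijOn.image_eq] at hd
    set ψ := Function.invFunOn φ unitDisk
    have hψ : ∀ w ∈ Ω, ψ w ∈ unitDisk ∧ φ (ψ w) = w := by
      intro w hw
      rw [← hφ.bijOn.image_eq] at hw
      obtain ⟨x, hx, rfl⟩ := hw
      rw [hL hx]
      exact ⟨hx, rfl⟩
    have hp : DifferentiableOn ℂ (fun z => 1 + z * deriv (deriv f) z / deriv f z) unitDisk :=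
      ((differentiableOn_id.mul hf2).div hf1 hf.deriv_ne_zero).const_add 1
    -- As a function of `z` this witness is a holomorphic self-map of the disk fixing `0`, so
    -- Schwarz bounds it by `‖z‖`.
    refine ⟨ψ (1 + z * deriv (deriv f) z / deriv f z), (hψ _ (hf.mem z hz)).1, ?_, ?_⟩
    · refine Complex.norm_le_norm_of_mapsTo_ball
        (f := fun z => ψ (1 + z * deriv (deriv f) z / deriv f z)) (R := 1) (hd.comp hp hf.mem)
        (fun w hw => ball_subset_closedBall (hψ _ (hf.mem w hw)).1) ?_ (by simpa [unitDisk] using hz)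
      simpa [hφ.map_zero] using hL h0
    · rw [(hψ _ (hf.mem z hz)).2, (hh z hz).deriv, Pi.div_apply]
      ring

/-! ### Arclength as a mean square, rotations and rigidity. -/

theorem arclength_eq_circleAverage (r : ℝ) (f : ℂ → ℂ) :
    arclength r f = 2 * Real.pi * (r * Real.circleAverage (fun z => ‖deriv f z‖) 0 r) := by
  have hper : Function.Periodic
      (fun θ : ℝ => r * ‖deriv f ((r : ℂ) * exp ((θ : ℂ) * I))‖) (2 * Real.pi) := by
    intro θ
    have h2 : exp (((θ + 2 * Real.pi : ℝ) : ℂ) * I) = exp ((θ : ℂ) * I) := by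
      push_cast
      rw [add_mul, exp_periodic]
    simp only [h2]
  have h1 := hper.intervalIntegral_add_eq (-Real.pi) 0
  rw [show -Real.pi + 2 * Real.pi = Real.pi by ring, zero_add] at h1
  rw [arclength, h1, intervalIntegral.integral_const_mul, Real.circleAverage]
  simp only [circleMap, zero_add, smul_eq_mul]
  have := Real.pi_pos.ne'
  field_simp
  simp only [mul_comm I]

theorem circleAverage_rotate {E : Type*} [NormedAddCommGroup E] [NormedSpace ℝ E] (u : ℂ → E)
    (r : ℝ) {ε : ℂ} (hε : ‖ε‖ = 1) :
    Real.circleAverage (fun z => u (ε * z)) 0 r = Real.circleAverage u 0 r := by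
  have hε' : exp ((ε.arg : ℂ) * I) = ε := by simpa [hε] using norm_mul_exp_arg_mul_I ε
  rw [Real.circleAverage_eq_integral_add (f := u) ε.arg, Real.circleAverage]
  congr 2
  funext θ
  congr 1
  simp only [circleMap, zero_add]
  push_cast
  rw [add_mul, exp_add, hε']
  ring

theorem circleAverage_norm_exp {g u : ℂ → ℂ} {r : ℝ} (hr : 0 < r)
    (h : ∀ z ∈ sphere (0 : ℂ) r, u z = exp (g z)) :
    Real.circleAverage (fun z => ‖u z‖) 0 r = meanSq (fun z => exp (g z / 2)) r := by
  refine Real.circleAverage_congr_sphere fun z hz => ?_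
  rw [abs_of_pos hr] at hz
  simp only
  rw [h z hz, ← norm_pow, ← exp_nat_mul]
  congr 2
  push_cast
  ring

theorem exists_eq_mul_of_norm_eq {ω : ℂ → ℂ} {ρ : ℝ} (hω : DifferentiableOn ℂ ω (ball 0 ρ))
    (hle : ∀ z ∈ ball (0 : ℂ) ρ, ‖ω z‖ ≤ ‖z‖) {z₀ : ℂ} (hz₀ : z₀ ∈ ball (0 : ℂ) ρ) (hne : z₀ ≠ 0)
    (heq : ‖ω z₀‖ = ‖z₀‖) : ∃ ε : ℂ, ‖ε‖ = 1 ∧ ∀ z ∈ ball (0 : ℂ) ρ, ω z = ε * z := by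
  have hρ : 0 < ρ := pos_of_mem_ball hz₀
  have hω0 : ω 0 = 0 := by simpa using hle 0 (mem_ball_self hρ)
  obtain ⟨ε, hε, h⟩ := affine_of_mapsTo_ball_of_exists_norm_dslope_eq_div' (R₂ := ρ) hω
    (fun z hz => by
      rw [hω0, mem_closedBall_zero_iff]
      exact (hle z hz).trans (mem_ball_zero_iff.1 hz).le)
    ⟨z₀, hz₀, by
      rw [dslope_of_ne _ hne, slope_def_field, hω0, sub_zero, sub_zero, norm_div, heq,
        div_self (norm_ne_zero_iff.2 hne), div_self hρ.ne']⟩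
  refine ⟨ε, by rw [hε, div_self hρ.ne'], fun z hz => ?_⟩
  simpa [hω0, mul_comm] using h hz

theorem mul_mem_unitDisk {ε z : ℂ} (hε : ‖ε‖ = 1) (hz : z ∈ unitDisk) : ε * z ∈ unitDisk := by
  simpa [unitDisk, hε] using hz

theorem hasDerivAt_rotate {k : ℂ → ℂ} {k' ε z : ℂ} (hε : ‖ε‖ = 1) (hk : HasDerivAt k k' (ε * z)) :
    HasDerivAt (fun z => (starRingEnd ℂ) ε * k (ε * z)) k' z := by
  have h1 : HasDerivAt (fun z => ε * z) ε z := by simpa using (hasDerivAt_id z).const_mul ε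
  refine ((hk.comp z h1).const_mul ((starRingEnd ℂ) ε)).congr_deriv ?_
  have h2 : (starRingEnd ℂ) ε * ε = 1 := by
    rw [mul_comm, mul_conj, normSq_eq_norm_sq, hε]
    simp
  linear_combination k' * h2

/-- Two holomorphic functions on the disk, with the same value at `0` and the same derivative on
a disk about `0`, agree. -/
theorem eqOn_unitDisk_of_deriv_eq {f₁ f₂ : ℂ → ℂ} (h₁ : DifferentiableOn ℂ f₁ unitDisk)
    (h₂ : DifferentiableOn ℂ f₂ unitDisk) (h0 : f₁ 0 = f₂ 0) {ρ : ℝ} (hρ : 0 < ρ) (hρ1 : ρ ≤ 1)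
    (h : ∀ z ∈ ball (0 : ℂ) ρ, deriv f₁ z = deriv f₂ z) : EqOn f₁ f₂ unitDisk := by
  have hsub : ball (0 : ℂ) ρ ⊆ unitDisk := ball_subset_ball hρ1
  have hloc : EqOn f₁ f₂ (ball 0 ρ) :=
    isOpen_ball.eqOn_of_deriv_eq (convex_ball (0 : ℂ) ρ).isPreconnected (h₁.mono hsub)
      (h₂.mono hsub) h (mem_ball_self hρ) h0
  refine (h₁.analyticOnNhd isOpen_ball).eqOn_of_preconnected_of_eventuallyEq
    (h₂.analyticOnNhd isOpen_ball) (convex_ball (0 : ℂ) 1).isPreconnected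
    (hsub (mem_ball_self hρ)) ?_
  filter_upwards [ball_mem_nhds (0 : ℂ) hρ] with z hz using hloc hz

end ArclengthProblem

/-! ### The arclength inequality and its equality case. -/

theorem theorem1 (Ω : Set ℂ) (hΩ_open : IsOpen Ω) (hΩ_one : (1 : ℂ) ∈ Ω) (hΩ_ne : Ω ≠ Set.univ)
    (hΩ_star : StarConvex ℝ (1 : ℂ) Ω)
    (φ : ℂ → ℂ) (hφ : ArclengthProblem.IsNormalizedConformalMap φ Ω)
    (f : ℂ → ℂ) (hf : ArclengthProblem.ClassC Ω f) (r : ℝ) (hr0 : 0 < r) (hr1 : r < 1) :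
    ArclengthProblem.arclength r f ≤
        ArclengthProblem.arclength r (ArclengthProblem.extremalFunction φ) ∧
      (ArclengthProblem.arclength r f =
          ArclengthProblem.arclength r (ArclengthProblem.extremalFunction φ) ↔
        ∃ ε : ℂ, ‖ε‖ = 1 ∧ ∀ z ∈ ArclengthProblem.unitDisk,
          f z = (starRingEnd ℂ) ε * ArclengthProblem.extremalFunction φ (ε * z)) := by
  open ArclengthProblem Metric Complex in
  obtain ⟨G, hG0, hG, hk⟩ := exists_log_deriv_extremalFunction hφ
  obtain ⟨h, hh0, hhd, hfh, hh⟩ := exists_log_deriv_of_classC hφ hf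
  have h0 : (0 : ℂ) ∈ unitDisk := mem_ball_self one_pos
  have hGd : DifferentiableOn ℂ G unitDisk := fun z hz =>
    (hG z hz).differentiableAt.differentiableWithinAt
  obtain ⟨ρ, hrρ, hρ1⟩ := exists_between hr1
  have hρ0 : 0 < ρ := hr0.trans hrρ
  have hsub : ball (0 : ℂ) ρ ⊆ unitDisk := ball_subset_ball hρ1.le
  have hsph : ∀ z ∈ sphere (0 : ℂ) r, z ∈ ball (0 : ℂ) ρ := fun z hz => by
    rw [mem_sphere_zero_iff_norm] at hz
    rwa [mem_ball_zero_iff, hz]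
  obtain ⟨ω, hωd, hω0, hω⟩ := exists_subordination hΩ_star hρ0 hρ1 hφ hGd hG0
    (fun z hz => by rw [(hG z hz).deriv]; exact dslope_ne_zero_of_conformal hφ hz)
    (fun z hz => by rw [(hG z hz).deriv, ← sub_eq_mul_dslope, hφ.map_zero]) hhd hh0 hh
  have hle : ∀ z ∈ ball (0 : ℂ) ρ, ‖ω z‖ ≤ ‖z‖ := fun z hz => (hω z hz).1
  have hQd : DifferentiableOn ℂ (fun z => exp (G z / 2)) (ball 0 ρ) :=
    ((hGd.mono hsub).div_const 2).cexp
  have hQ' : deriv (fun z => exp (G z / 2)) 0 ≠ 0 := by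
    rw [((hG 0 h0).div_const 2).cexp.deriv]
    exact mul_ne_zero (exp_ne_zero _)
      (div_ne_zero (dslope_ne_zero_of_conformal hφ h0) two_ne_zero)
  have hLf : arclength r f = 2 * Real.pi * (r * meanSq (fun z => exp (G (ω z) / 2)) r) := by
    rw [arclength_eq_circleAverage, circleAverage_norm_exp (g := fun z => G (ω z)) hr0]
    intro z hz
    rw [hfh z (hsub (hsph z hz)), (hω z (hsph z hz)).2]
  have hLk : arclength r (extremalFunction φ) =
      2 * Real.pi * (r * meanSq (fun z => exp (G z / 2)) r) := by
    rw [arclength_eq_circleAverage, circleAverage_norm_exp hr0]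
    exact fun z hz => (hk z (hsub (hsph z hz))).deriv
  have hπ := Real.pi_pos
  refine ⟨?_, fun heq => ?_, ?_⟩
  · rw [hLf, hLk]
    have := meanSq_comp_le hr0 hrρ hQd hωd hle
    gcongr
  -- Equality excludes the strict Littlewood inequality, so the Schwarz bound is attained on the
  -- circle and `ω` is a rotation on the disk of radius `ρ`; the identity theorem extends the
  -- conclusion to the unit disk.
  · obtain ⟨z₀, hz₀, hge⟩ : ∃ z ∈ sphere (0 : ℂ) r, r ≤ ‖ω z‖ := by
      by_contra! hlt
      have h1 := meanSq_comp_lt hr0 hrρ hQd hωd hle hlt hQ'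
      refine absurd heq (ne_of_lt ?_)
      rw [hLf, hLk]
      gcongr
    have hz₀r : ‖z₀‖ = r := mem_sphere_zero_iff_norm.1 hz₀
    obtain ⟨ε, hε, hrot⟩ := exists_eq_mul_of_norm_eq hωd hle (hsph z₀ hz₀)
      (norm_pos_iff.1 (hz₀r ▸ hr0))
      (le_antisymm (hle z₀ (hsph z₀ hz₀)) (hz₀r ▸ hge))
    have hder : ∀ z ∈ unitDisk, HasDerivAt
        (fun z => (starRingEnd ℂ) ε * extremalFunction φ (ε * z)) (exp (G (ε * z))) z :=
      fun z hz => hasDerivAt_rotate hε (hk _ (mul_mem_unitDisk hε hz))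
    refine ⟨ε, hε, eqOn_unitDisk_of_deriv_eq hf.holomorphic
      (fun z hz => (hder z hz).differentiableAt.differentiableWithinAt) ?_ hρ0 hρ1.le ?_⟩
    · simp [hf.map_zero, extremalFunction_zero]
    · intro z hz
      rw [(hder z (hsub hz)).deriv, hfh z (hsub hz), ← (hω z hz).2, hrot z hz]
  · rintro ⟨ε, hε, hfε⟩
    rw [arclength_eq_circleAverage, arclength_eq_circleAverage,
      ← circleAverage_rotate (fun z => ‖deriv (extremalFunction φ) z‖) r hε]
    congr 2
    refine Real.circleAverage_congr_sphere fun z hz => ?_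
    rw [abs_of_pos hr0] at hz
    have hzD := hsub (hsph z hz)
    have hkz := hk _ (mul_mem_unitDisk hε hzD)
    have hev : f =ᶠ[nhds z] fun z => (starRingEnd ℂ) ε * extremalFunction φ (ε * z) := by
      filter_upwards [isOpen_ball.mem_nhds hzD] with w hw using hfε w hw
    rw [hev.deriv_eq, (hasDerivAt_rotate hε hkz).deriv, hkz.deriv]
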